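/- Let $T>0$, let $p\in C^1(\mathbb R)$ and $q\in C(\mathbb R)$ be real-valued and $T$-periodic with $p(x)>0$ for all $x$, and consider $$-(p f')'+q f=\lambda f. \qquad (1)$$ For $\lambda\in\mathbb C$ let $f_1(\cdot,\lambda),f_2(\cdot,\lambda)$ be the solutions of (1) with $f_1(0,\lambda)=1$, $f_1'(0,\lambda)=0$, $f_2(0,\lambda)=0$, $f_2'(0,\lambda)=1$, and let $D(\lambda)=f_1(T,\lambda)+f_2'(T,\lambda)$ be Hill's discriminant of (1). Let $\lambda_0$ be the lowest eigenvalue of (1) on $[0,T]$ with periodic boundary conditions $f(0)=f(T)$, $f'(0)=f'(T)$, and let $f_0$ be a corresponding eigenfunction, extended to $\mathbb R$ as a solution of (1) with $\lambda=\lambda_0$. Then $f_0$ has no zeros. Define $\tilde X^{(0)}\equiv X^{(0)}\equiv 1$ and, for $n\ge 1$, $$\tilde X^{(n)}(x)=\begin{cases}\displaystyle\int_0^x \tilde X^{(n-1)}(\xi)f_0^2(\xi)\,d\xi, & n\text{ odd},\\[2mm] \displaystyle-\int_0^x \tilde X^{(n-1)}(\xi)\frac{d\xi}{p(\xi)f_0^2(\xi)},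 & n\text{ even},\end{cases}$$ $$X^{(n)}(x)=\begin{cases}\displaystyle-\int_0^x X^{(n-1)}(\xi)\frac{d\xi}{p(\xi)f_0^2(\xi)}, & n\text{ odd},\\[2mm] \displaystyle\int_0^x X^{(n-1)}(\xi)f_0^2(\xi)\,d\xi, & n\text{ even}.\end{cases}$$ Then for every $\lambda\in\mathbb C$ $$D(\lambda)=\sum_{n=0}^\infty\bigl(\tilde X^{(2n)}(T)+X^{(2n)}(T)\bigr)(\lambda-\lambda_0)^n,$$ and the series converges uniformly on every compact set of values of $\lambda\in\mathbb C$. -/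

import Mathlib

/-- `f` is a classical solution on the real line of `-(p f')' + q f = μ f`, where `μ` is a complex
spectral parameter. -/
def IsHillSolution (p q : ℝ → ℝ) (μ : ℂ) (f : ℝ → ℂ) : Prop :=
  Differentiable ℝ f ∧ Differentiable ℝ (fun x => (p x : ℂ) * deriv f x) ∧
    ∀ x : ℝ, -deriv (fun y => (p y : ℂ) * deriv f y) x + (q x : ℂ) * f x = μ * f x

/-- `f₁, f₂` are the solutions with `f₁(0) = 1`, `f₁'(0) = 0`, `f₂(0) = 0`, `f₂'(0) = 1`. -/
def IsFundamentalSystem (p q : ℝ → ℝ) (μ : ℂ) (f₁ f₂ : ℝ → ℂ) : Prop :=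
  IsHillSolution p q μ f₁ ∧ IsHillSolution p q μ f₂ ∧
    f₁ 0 = 1 ∧ deriv f₁ 0 = 0 ∧ f₂ 0 = 0 ∧ deriv f₂ 0 = 1

/-- `D` is Hill's discriminant, `D(μ) = f₁(T, μ) + f₂'(T, μ)`: for every complex `μ` the fundamental
system exists, and `D(μ)` is the value it gives. At most one function `D` has this property. -/
def IsHillDiscriminant (p q : ℝ → ℝ) (T : ℝ) (D : ℂ → ℂ) : Prop :=
  ∀ μ : ℂ, (∃ f₁ f₂ : ℝ → ℂ, IsFundamentalSystem p q μ f₁ f₂) ∧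
    ∀ f₁ f₂ : ℝ → ℂ, IsFundamentalSystem p q μ f₁ f₂ → D μ = f₁ T + deriv f₂ T

/-- `f` is an eigenfunction for the parameter `μ` of the problem on `[0, T]` with periodic
boundary conditions (with periodic coefficients, every solution on `[0, T]` satisfying these
conditions extends to a solution on the real line). -/
def IsPeriodicEigenfunction (p q : ℝ → ℝ) (T : ℝ) (μ : ℂ) (f : ℝ → ℂ) : Prop :=
  IsHillSolution p q μ f ∧ f ≠ 0 ∧ f 0 = f T ∧ deriv f 0 = deriv f T

/-- The set of (real) eigenvalues of the problem with periodic boundary conditions. -/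
def periodicEigenvalues (p q : ℝ → ℝ) (T : ℝ) : Set ℝ :=
  {μ : ℝ | ∃ f : ℝ → ℂ, IsPeriodicEigenfunction p q T (μ : ℂ) f}

/-- The iterated integrals with a tilde: integration against `f₀²` at odd steps and against
`-1 / (p f₀²)` at even steps. -/
noncomputable def sppsXTilde (p : ℝ → ℝ) (f₀ : ℝ → ℂ) : ℕ → ℝ → ℂ
  | 0 => fun _ => 1
  | n + 1 => fun x =>
      if Odd (n + 1) then ∫ ξ in (0 : ℝ)..x, sppsXTilde p f₀ n ξ * f₀ ξ ^ 2
      else -∫ ξ in (0 : ℝ)..x, sppsXTilde p f₀ n ξ * (1 / ((p ξ : ℂ) * f₀ ξ ^ 2))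

/-- The iterated integrals without a tilde: integration against `-1 / (p f₀²)` at odd steps and
against `f₀²` at even steps. -/
noncomputable def sppsX (p : ℝ → ℝ) (f₀ : ℝ → ℂ) : ℕ → ℝ → ℂ
  | 0 => fun _ => 1
  | n + 1 => fun x =>
      if Odd (n + 1) then -∫ ξ in (0 : ℝ)..x, sppsX p f₀ n ξ * (1 / ((p ξ : ℂ) * f₀ ξ ^ 2))
      else ∫ ξ in (0 : ℝ)..x, sppsX p f₀ n ξ * f₀ ξ ^ 2

/-!
Everything rests on the first-order system `u' = a w`, `w' = b u`. Its Picard iterates are the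
alternating iterated integrals `altInt` of `a` and `b`; the sums `altCosh` and `altSinh` over the
even and the odd orders form its transfer matrix, whose determinant is `1`
(`altCosh_mul_sub_altSinh_mul`). Constancy of the Wronskian gives uniqueness
(`SolvesSystem.eq_comb`). The system is used with two choices of the weights.

With `a = 1 / p`, `b = q - μ` it is Hill's equation for `f` and its quasi-derivative `p f'`, and
`μ` is a periodic eigenvalue as soon as the transfer matrix over a period has trace `2`
(`exists_isPeriodicEigenfunction_of_trace`). Suppose the lowest eigenfunction has a zero. After a
translation the zero is at `0`, so the sine-like solution is periodic at `lam₀`: it vanishes at `T`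
with positive derivative. For `μ` below `min q` this solution is positive on `(0, T]`. At the least
`μ` for which it has a zero in `(0, T]`, this zero is at `T` and the derivative there is negative
(`exists_lt_altSinh_eq_zero_altCosh_neg`), so that the transfer matrix, which is triangular with
determinant `1`, has negative trace. Below `min q` the trace is at least `2`, hence it takes the
value `2` in between (`exists_lt_trace_eq_two`), which yields an eigenvalue smaller than `lam₀`:
a contradiction.

With `a = -1 / (p f₀²)`, `b = (μ - lam₀) f₀²` the system is what reduction of order `f = f₀ v` makes
of Hill's equation (`solvesSystem_mul`). As `f₀` is periodic, the trace of the transfer matrix does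
not change (`IsFundamentalSystem.trace_eq`), and the `n`-th term of `altCosh` carries the factor
`(μ - lam₀) ^ n` (`altInt_const_mul_even`). This is the power series for the discriminant; it
converges for all `μ`, hence uniformly on compact sets.
-/

/-! ### Alternating iterated integrals -/

section IteratedIntegrals

open Set Filter Topology

variable {𝕜 : Type*} [RCLike 𝕜]

/-- The alternating iterated integrals of two weights `a` and `b`: `J₀ = 1` and
`Jₙ₊₁(a, b)(x) = ∫₀ˣ a Jₙ(b, a)`. The outermost integration is always against the first weight,
so the two weights are exchanged in the recursive call. -/
noncomputable def altInt : ℕ → (ℝ → 𝕜) → (ℝ → 𝕜) → ℝ → 𝕜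
  | 0, _, _, _ => 1
  | n + 1, a, b, x => ∫ t in (0 : ℝ)..x, a t * altInt n b a t

lemma continuous_altInt_uncurry {P : Type*} [TopologicalSpace P] [FirstCountableTopology P]
    (n : ℕ) {a b : P → ℝ → 𝕜}
    (ha : Continuous (Function.uncurry a)) (hb : Continuous (Function.uncurry b)) :
    Continuous fun z : P × ℝ => altInt n (a z.1) (b z.1) z.2 := by
  induction n generalizing a b with
  | zero => exact continuous_const
  | succ n ih =>
    have h := ih hb ha
    refine intervalIntegral.continuous_parametric_intervalIntegral_of_continuous
      (f := fun (z : P × ℝ) t => a z.1 t * altInt n (b z.1) (a z.1) t) ?_ continuous_snd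
    have e : Continuous fun w : (P × ℝ) × ℝ => ((w.1.1, w.2) : P × ℝ) := by fun_prop
    exact (ha.comp e).mul (h.comp e)

lemma continuous_altInt (n : ℕ) {a b : ℝ → 𝕜} (ha : Continuous a) (hb : Continuous b) :
    Continuous (altInt n a b) := by
  have h := continuous_altInt_uncurry (P := Unit) n (a := fun _ => a) (b := fun _ => b)
    (ha.comp continuous_snd) (hb.comp continuous_snd)
  exact h.comp (Continuous.prodMk_right ())

lemma hasDerivAt_altInt_succ (n : ℕ) {a b : ℝ → 𝕜} (ha : Continuous a) (hb : Continuous b)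
    (x : ℝ) : HasDerivAt (altInt (n + 1) a b) (a x * altInt n b a x) x :=
  ((ha.mul (continuous_altInt n hb ha)).integral_hasStrictDerivAt 0 x).hasDerivAt

lemma altInt_succ_zero (n : ℕ) (a b : ℝ → 𝕜) : altInt (n + 1) a b 0 = 0 := by
  simp [altInt]

/-- The factorial bound that makes the series of iterated integrals converge. -/
lemma norm_altInt_le (n : ℕ) {a b : ℝ → 𝕜} (ha : Continuous a) (hb : Continuous b)
    {M R : ℝ} (haM : ∀ t, |t| ≤ R → ‖a t‖ ≤ M) (hbM : ∀ t, |t| ≤ R → ‖b t‖ ≤ M)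
    {x : ℝ} (hx : |x| ≤ R) : ‖altInt n a b x‖ ≤ (M * |x|) ^ n / n.factorial := by
  induction n generalizing a b x with
  | zero => simp [altInt]
  | succ n ih =>
    have hM : 0 ≤ M := (norm_nonneg _).trans (haM x hx)
    have key : ‖altInt (n + 1) a b x‖ ≤
        ∫ t in uIoc (0 : ℝ) x, M ^ (n + 1) / n.factorial * |t - 0| ^ n := by
      refine (intervalIntegral.norm_integral_le_integral_norm_uIoc).trans ?_
      refine MeasureTheory.setIntegral_mono_on ?_ ?_ measurableSet_uIoc ?_
      · exact (((ha.mul (continuous_altInt n hb ha)).norm).intervalIntegrable 0 x).def'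
      · exact ((by fun_prop : Continuous fun t : ℝ =>
          M ^ (n + 1) / n.factorial * |t - 0| ^ n).intervalIntegrable 0 x).def'
      · intro t ht
        have htx : |t| ≤ |x| := by
          rcases le_total 0 x with h | h
          · rw [uIoc_of_le h] at ht
            rw [abs_of_pos ht.1, abs_of_nonneg h]; exact ht.2
          · rw [uIoc_of_ge h] at ht
            rw [abs_of_nonpos ht.2, abs_of_nonpos h]; linarith [ht.1]
        have h1 := haM t (htx.trans hx)
        have h2 := ih hb ha hbM haM (htx.trans hx)
        calc ‖a t * altInt n b a t‖ = ‖a t‖ * ‖altInt n b a t‖ := norm_mul _ _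
          _ ≤ M * ((M * |t|) ^ n / n.factorial) := by gcongr
          _ = M ^ (n + 1) / n.factorial * |t - 0| ^ n := by rw [sub_zero]; ring
    refine key.trans (le_of_eq ?_)
    rw [MeasureTheory.integral_const_mul, integral_pow_abs_sub_uIoc, sub_zero,
      Nat.factorial_succ]
    push_cast
    field_simp
    ring

/-- Multiplying one weight by a constant `c` multiplies an iterated integral by `c` once for every
integration against that weight. -/
lemma altInt_const_mul_even (c : 𝕜) (n : ℕ) (a b : ℝ → 𝕜) (x : ℝ) :
    altInt (2 * n) a (fun t => c * b t) x = c ^ n * altInt (2 * n) a b x ∧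
      altInt (2 * n) (fun t => c * b t) a x = c ^ n * altInt (2 * n) b a x := by
  induction n generalizing x with
  | zero => simp [altInt]
  | succ n ih =>
    have e : 2 * (n + 1) = 2 * n + 1 + 1 := by ring
    have e1 (y : ℝ) : altInt (2 * n + 1) (fun t => c * b t) a y
        = c ^ (n + 1) * altInt (2 * n + 1) b a y := by
      simp only [altInt]
      rw [← intervalIntegral.integral_const_mul]
      congr 1; ext t; rw [(ih t).1]; ring
    have e2 (y : ℝ) : altInt (2 * n + 1) a (fun t => c * b t) y
        = c ^ n * altInt (2 * n + 1) a b y := by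
      simp only [altInt]
      rw [← intervalIntegral.integral_const_mul]
      congr 1; ext t; rw [(ih t).2]; ring
    rw [e]
    constructor
    · rw [altInt, altInt, ← intervalIntegral.integral_const_mul]
      congr 1; ext t; rw [e1]; ring
    · rw [altInt, altInt, ← intervalIntegral.integral_const_mul]
      congr 1; ext t; rw [e2]; ring

lemma altInt_nonneg (n : ℕ) {a b : ℝ → ℝ} {R x : ℝ} (ha : ∀ t ∈ Icc 0 R, 0 ≤ a t)
    (hb : ∀ t ∈ Icc 0 R, 0 ≤ b t) (hx : x ∈ Icc 0 R) : 0 ≤ altInt n a b x := by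
  induction n generalizing a b x with
  | zero => simp [altInt]
  | succ n ih =>
    refine intervalIntegral.integral_nonneg hx.1 fun t ht => ?_
    have ht' : t ∈ Icc 0 R := ⟨ht.1, ht.2.trans hx.2⟩
    exact mul_nonneg (ha t ht') (ih hb ha ht')

lemma altInt_ofReal (n : ℕ) (a b : ℝ → ℝ) (x : ℝ) :
    altInt n (fun t => (a t : ℂ)) (fun t => (b t : ℂ)) x = ((altInt n a b x : ℝ) : ℂ) := by
  induction n generalizing a b x with
  | zero => simp [altInt]
  | succ n ih =>
    simp only [altInt, ih]
    rw [← intervalIntegral.integral_ofReal]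
    simp

end IteratedIntegrals

/-! ### The cosine-like and sine-like series -/

section Series

open Set Filter Topology

variable {𝕜 : Type*} [RCLike 𝕜]

lemma exists_norm_le_of_abs_le {a : ℝ → 𝕜} (ha : Continuous a) (R : ℝ) :
    ∃ M, ∀ t, |t| ≤ R → ‖a t‖ ≤ M := by
  obtain ⟨M, hM⟩ := (isCompact_Icc (a := -R) (b := R)).exists_bound_of_continuousOn
    ha.continuousOn
  exact ⟨M, fun t ht => hM t (abs_le.1 ht)⟩

lemma summable_altInt {k : ℕ → ℕ} (hk : k.Injective) {a b : ℝ → 𝕜} (ha : Continuous a)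
    (hb : Continuous b) (x : ℝ) : Summable fun n => altInt (k n) a b x := by
  obtain ⟨M₁, h₁⟩ := exists_norm_le_of_abs_le ha |x|
  obtain ⟨M₂, h₂⟩ := exists_norm_le_of_abs_le hb |x|
  refine Summable.of_norm_bounded
    ((Real.summable_pow_div_factorial (max M₁ M₂ * |x|)).comp_injective hk) fun n => ?_
  exact norm_altInt_le (k n) ha hb (fun t ht => (h₁ t ht).trans (le_max_left _ _))
    (fun t ht => (h₂ t ht).trans (le_max_right _ _)) le_rfl

/-- The series depend continuously on the point and on a parameter of the weights jointly. -/
lemma continuous_tsum_altInt {P : Type*} [TopologicalSpace P] [FirstCountableTopology P]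
    [LocallyCompactSpace P] {k : ℕ → ℕ} (hk : k.Injective) {a b : P → ℝ → 𝕜}
    (ha : Continuous (Function.uncurry a)) (hb : Continuous (Function.uncurry b)) :
    Continuous fun z : P × ℝ => ∑' n, altInt (k n) (a z.1) (b z.1) z.2 := by
  rw [continuous_iff_continuousAt]
  rintro ⟨l, x⟩
  obtain ⟨K, hK, hlK⟩ := exists_compact_mem_nhds l
  set R := |x| + 1
  have hR : 0 ≤ R := by positivity
  have hKR : IsCompact (K ×ˢ Icc (-R) R) := hK.prod isCompact_Icc
  obtain ⟨M₁, h₁⟩ := hKR.exists_bound_of_continuousOn ha.continuousOn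
  obtain ⟨M₂, h₂⟩ := hKR.exists_bound_of_continuousOn hb.continuousOn
  have hM : 0 ≤ max M₁ M₂ := le_max_of_le_left <| (norm_nonneg _).trans <|
    h₁ (l, 0) ⟨mem_of_mem_nhds hlK, by simpa using hR⟩
  have hcont : ContinuousOn (fun z : P × ℝ => ∑' n, altInt (k n) (a z.1) (b z.1) z.2)
      (K ×ˢ Icc (-R) R) := by
    refine continuousOn_tsum (fun n => (continuous_altInt_uncurry (k n) ha hb).continuousOn)
      ((Real.summable_pow_div_factorial (max M₁ M₂ * R)).comp_injective hk) ?_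
    rintro n ⟨m, y⟩ ⟨hm, hy⟩
    have hy' : |y| ≤ R := abs_le.2 hy
    refine (norm_altInt_le (k n) (M := max M₁ M₂) (R := R)
      (ha.comp (Continuous.prodMk_right m)) (hb.comp (Continuous.prodMk_right m))
      (fun t ht => ?_) (fun t ht => ?_) hy').trans ?_
    · exact (h₁ (m, t) ⟨hm, abs_le.1 ht⟩).trans (le_max_left _ _)
    · exact (h₂ (m, t) ⟨hm, abs_le.1 ht⟩).trans (le_max_right _ _)
    · simp only [Function.comp]
      gcongr
  refine hcont.continuousAt (prod_mem_nhds hlK (Icc_mem_nhds ?_ ?_))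
  · have := neg_abs_le x; simp only [R]; linarith
  · have := le_abs_self x; simp only [R]; linarith

lemma hasDerivAt_tsum_altInt_succ {k : ℕ → ℕ} (hk : k.Injective) {a b : ℝ → 𝕜}
    (ha : Continuous a) (hb : Continuous b) (x : ℝ) :
    HasDerivAt (fun y => ∑' n, altInt (k n + 1) a b y) (a x * ∑' n, altInt (k n) b a x) x := by
  set R := |x| + 1
  have hR : 0 ≤ R := by positivity
  obtain ⟨M₁, h₁⟩ := exists_norm_le_of_abs_le ha R
  obtain ⟨M₂, h₂⟩ := exists_norm_le_of_abs_le hb R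
  have hM₁ : 0 ≤ M₁ := (norm_nonneg _).trans (h₁ 0 (by simpa using hR))
  have hM : 0 ≤ max M₁ M₂ := le_max_of_le_left hM₁
  rw [← tsum_mul_left]
  refine hasDerivAt_tsum_of_isPreconnected (t := Ioo (-R) R) (y₀ := 0)
    (u := fun n => M₁ * ((max M₁ M₂ * R) ^ k n / (k n).factorial)) ?_ isOpen_Ioo
    isPreconnected_Ioo (fun n y _ => hasDerivAt_altInt_succ (k n) ha hb y) ?_ ?_ ?_ ?_
  · exact ((Real.summable_pow_div_factorial (max M₁ M₂ * R)).comp_injective hk).mul_left M₁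
  · intro n y hy
    have hy' : |y| ≤ R := (abs_lt.2 hy).le
    rw [norm_mul]
    refine mul_le_mul (h₁ y hy') ?_ (norm_nonneg _) hM₁
    refine (norm_altInt_le (k n) (M := max M₁ M₂) hb ha
      (fun t ht => (h₂ t ht).trans (le_max_right _ _))
      (fun t ht => (h₁ t ht).trans (le_max_left _ _)) hy').trans ?_
    gcongr
  · have : (0 : ℝ) < R := by positivity
    exact ⟨by linarith, this⟩
  · simp [altInt_succ_zero]
  · have h1 := neg_abs_le x
    have h2 := le_abs_self x
    constructor <;> simp only [R] <;> linarith

/-- The sum of the alternating iterated integrals of even order; for `a = b = 1` it is `cosh`. -/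
noncomputable def altCosh (a b : ℝ → 𝕜) (x : ℝ) : 𝕜 := ∑' n : ℕ, altInt (2 * n) a b x

/-- The sum of the alternating iterated integrals of odd order; for `a = b = 1` it is `sinh`. -/
noncomputable def altSinh (a b : ℝ → 𝕜) (x : ℝ) : 𝕜 := ∑' n : ℕ, altInt (2 * n + 1) a b x

lemma two_mul_injective : Function.Injective fun n : ℕ => 2 * n :=
  fun _ _ h => by simpa using h

lemma two_mul_add_one_injective : Function.Injective fun n : ℕ => 2 * n + 1 :=
  fun _ _ h => by simpa using h

lemma hasDerivAt_altSinh {a b : ℝ → 𝕜} (ha : Continuous a) (hb : Continuous b) (x : ℝ) :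
    HasDerivAt (altSinh a b) (a x * altCosh b a x) x :=
  hasDerivAt_tsum_altInt_succ two_mul_injective ha hb x

lemma hasDerivAt_altCosh {a b : ℝ → 𝕜} (ha : Continuous a) (hb : Continuous b) (x : ℝ) :
    HasDerivAt (altCosh a b) (a x * altSinh b a x) x := by
  have h : altCosh a b = fun y => 1 + ∑' n : ℕ, altInt (2 * n + 1 + 1) a b y := by
    ext y
    rw [altCosh, (summable_altInt two_mul_injective ha hb y).tsum_eq_zero_add]
    rfl
  rw [h]
  exact (hasDerivAt_tsum_altInt_succ two_mul_add_one_injective ha hb x).const_add 1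

lemma altSinh_zero (a b : ℝ → 𝕜) : altSinh a b 0 = 0 := by
  simp [altSinh, altInt_succ_zero]

lemma altCosh_zero {a b : ℝ → 𝕜} (ha : Continuous a) (hb : Continuous b) :
    altCosh a b 0 = 1 := by
  rw [altCosh, (summable_altInt two_mul_injective ha hb 0).tsum_eq_zero_add]
  have (n : ℕ) : altInt (2 * (n + 1)) a b 0 = 0 := altInt_succ_zero (2 * n + 1) a b
  simp [this, altInt]

lemma altCosh_ofReal (a b : ℝ → ℝ) (x : ℝ) :
    altCosh (fun t => (a t : ℂ)) (fun t => (b t : ℂ)) x = ((altCosh a b x : ℝ) : ℂ) := by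
  simp [altCosh, altInt_ofReal, Complex.ofReal_tsum]

lemma altSinh_ofReal (a b : ℝ → ℝ) (x : ℝ) :
    altSinh (fun t => (a t : ℂ)) (fun t => (b t : ℂ)) x = ((altSinh a b x : ℝ) : ℂ) := by
  simp [altSinh, altInt_ofReal, Complex.ofReal_tsum]

lemma one_le_altCosh {a b : ℝ → ℝ} (hac : Continuous a) (hbc : Continuous b) {R x : ℝ}
    (ha : ∀ t ∈ Icc 0 R, 0 ≤ a t) (hb : ∀ t ∈ Icc 0 R, 0 ≤ b t) (hx : x ∈ Icc 0 R) :
    1 ≤ altCosh a b x := by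
  have h := (summable_altInt two_mul_injective hac hbc x).le_tsum 0
    (fun n _ => altInt_nonneg (2 * n) ha hb hx)
  rwa [mul_zero, altInt] at h

end Series

/-! ### The system `u' = a w`, `w' = b u` -/

section LinearSystem

open Set Filter Topology

variable {𝕜 : Type*} [RCLike 𝕜]

/-- `(u, w)` solves the linear system `u' = a w`, `w' = b u` on the real line. -/
def SolvesSystem (a b u w : ℝ → 𝕜) : Prop :=
  ∀ x, HasDerivAt u (a x * w x) x ∧ HasDerivAt w (b x * u x) x

lemma solvesSystem_altCosh {a b : ℝ → 𝕜} (ha : Continuous a) (hb : Continuous b) :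
    SolvesSystem a b (altCosh a b) (altSinh b a) :=
  fun x => ⟨hasDerivAt_altCosh ha hb x, hasDerivAt_altSinh hb ha x⟩

lemma solvesSystem_altSinh {a b : ℝ → 𝕜} (ha : Continuous a) (hb : Continuous b) :
    SolvesSystem a b (altSinh a b) (altCosh b a) :=
  fun x => ⟨hasDerivAt_altSinh ha hb x, hasDerivAt_altCosh hb ha x⟩

/-- The Wronskian of two solutions is constant. -/
lemma SolvesSystem.wronskian_eq {a b u w u' w' : ℝ → 𝕜} (h : SolvesSystem a b u w)
    (h' : SolvesSystem a b u' w') (x : ℝ) : u x * w' x - u' x * w x = u 0 * w' 0 - u' 0 * w 0 := by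
  have hd (y : ℝ) : HasDerivAt (fun y => u y * w' y - u' y * w y) 0 y :=
    (((h y).1.mul (h' y).2).sub ((h' y).1.mul (h y).2)).congr_deriv (by ring)
  exact is_const_of_deriv_eq_zero (fun y => (hd y).differentiableAt) (fun y => (hd y).deriv) x 0

lemma altCosh_mul_sub_altSinh_mul {a b : ℝ → 𝕜} (ha : Continuous a) (hb : Continuous b) (x : ℝ) :
    altCosh a b x * altCosh b a x - altSinh a b x * altSinh b a x = 1 := by
  rw [(solvesSystem_altCosh ha hb).wronskian_eq (solvesSystem_altSinh ha hb) x]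
  simp [altCosh_zero ha hb, altCosh_zero hb ha, altSinh_zero]

/-- Every solution is a combination of the two series solutions. Its coefficients are read off
from the Wronskians with these two, so no Grönwall estimate is needed for uniqueness. -/
lemma SolvesSystem.eq_comb {a b u w : ℝ → 𝕜} (ha : Continuous a) (hb : Continuous b)
    (h : SolvesSystem a b u w) (x : ℝ) :
    u x = u 0 * altCosh a b x + w 0 * altSinh a b x ∧
      w x = u 0 * altSinh b a x + w 0 * altCosh b a x := by
  have h1 := h.wronskian_eq (solvesSystem_altCosh ha hb) x
  have h2 := h.wronskian_eq (solvesSystem_altSinh ha hb) x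
  have h3 := altCosh_mul_sub_altSinh_mul ha hb x
  simp only [altCosh_zero ha hb, altCosh_zero hb ha, altSinh_zero] at h1 h2
  constructor
  · linear_combination altCosh a b x * h2 - altSinh a b x * h1 - u x * h3
  · linear_combination altSinh b a x * h2 - altCosh b a x * h1 - w x * h3

end LinearSystem

/-! ### Zeros of the sine-like solution and the trace of the transfer matrix -/

section Oscillation

open Set Filter Topology

lemma continuous_altSinh_sub {a q : ℝ → ℝ} (ha : Continuous a) (hq : Continuous q) :
    Continuous fun z : ℝ × ℝ => altSinh a (fun t => q t - z.1) z.2 :=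
  continuous_tsum_altInt (P := ℝ) two_mul_add_one_injective (a := fun _ => a)
    (b := fun l t => q t - l) (ha.comp continuous_snd)
    ((hq.comp continuous_snd).sub continuous_fst)

lemma continuous_altCosh_sub {a q : ℝ → ℝ} (ha : Continuous a) (hq : Continuous q) :
    Continuous fun z : ℝ × ℝ => altCosh a (fun t => q t - z.1) z.2 :=
  continuous_tsum_altInt (P := ℝ) two_mul_injective (a := fun _ => a)
    (b := fun l t => q t - l) (ha.comp continuous_snd)
    ((hq.comp continuous_snd).sub continuous_fst)

lemma continuous_altCosh_sub' {a q : ℝ → ℝ} (ha : Continuous a) (hq : Continuous q) :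
    Continuous fun z : ℝ × ℝ => altCosh (fun t => q t - z.1) a z.2 :=
  continuous_tsum_altInt (P := ℝ) two_mul_injective (b := fun _ => a)
    (a := fun l t => q t - l) ((hq.comp continuous_snd).sub continuous_fst)
    (ha.comp continuous_snd)

/-- If `altSinh` vanishes at `T` for the parameter `l₀`, with positive quasi-derivative there, then
for a smaller parameter `l` it vanishes at `T` with negative quasi-derivative: `l` is the least
parameter for which there is a zero in `(0, T]`, so that this first zero can only be at `T`. -/
lemma exists_lt_altSinh_eq_zero_altCosh_neg {a q : ℝ → ℝ} (ha : Continuous a)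
    (hq : Continuous q) (ha_pos : ∀ x, 0 < a x) {T l₀ m : ℝ} (hT : 0 < T) (hml₀ : m ≤ l₀)
    (hm : ∀ x ∈ Icc 0 T, m ≤ q x)
    (hS : altSinh a (fun t => q t - l₀) T = 0) (hC : 0 < altCosh (fun t => q t - l₀) a T) :
    ∃ l ∈ Icc m l₀, l ≠ l₀ ∧ altSinh a (fun t => q t - l) T = 0 ∧
      altCosh (fun t => q t - l) a T < 0 := by
  have hb (l : ℝ) : Continuous fun t => q t - l := hq.sub continuous_const
  set Y : ℝ → ℝ → ℝ := fun l => altSinh a (fun t => q t - l) with hYdef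
  set Z : ℝ → ℝ → ℝ := fun l => altCosh (fun t => q t - l) a with hZdef
  have hYc : Continuous fun z : ℝ × ℝ => Y z.1 z.2 := continuous_altSinh_sub ha hq
  have hZc : Continuous fun z : ℝ × ℝ => Z z.1 z.2 := continuous_altCosh_sub' ha hq
  have hYx (l : ℝ) : Continuous (Y l) := hYc.comp (Continuous.prodMk_right l)
  have hY' (l x : ℝ) : HasDerivAt (Y l) (a x * Z l x) x := hasDerivAt_altSinh ha (hb l) x
  have hY0 (l : ℝ) : Y l 0 = 0 := altSinh_zero _ _
  have hYZ (l x : ℝ) (h : Y l x = 0) : Z l x ≠ 0 := by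
    intro h0
    have := altCosh_mul_sub_altSinh_mul ha (hb l) x
    simp only [hYdef, hZdef] at h h0
    simp [h, h0] at this
  -- `Y l` is positive to the right of the origin as long as `Z l` stays positive.
  have hpos (l r : ℝ) (hZ : ∀ x ∈ Icc 0 r, 0 < Z l x) (x : ℝ) (hx : x ∈ Ioc 0 r) : 0 < Y l x := by
    have hmono : StrictMonoOn (Y l) (Icc 0 r) := by
      refine strictMonoOn_of_deriv_pos (convex_Icc 0 r) (hYx l).continuousOn fun y hy => ?_
      rw [(hY' l y).deriv]
      exact mul_pos (ha_pos y) (hZ y (interior_subset hy))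
    have h := hmono ⟨le_rfl, hx.1.le.trans hx.2⟩ ⟨hx.1.le, hx.2⟩ hx.1
    rwa [hY0] at h
  -- By compactness one such interval serves for all the parameters in `[m, l₀]`.
  obtain ⟨δ, hδ0, hδ⟩ : ∃ δ > 0, ∀ l ∈ Icc m l₀, ∀ x ∈ Icc 0 δ, 0 < Z l x := by
    obtain ⟨u, v, -, hv, hu, h0v, huv⟩ := generalized_tube_lemma (s := Icc m l₀) (t := {(0 : ℝ)})
      isCompact_Icc isCompact_singleton (n := {z : ℝ × ℝ | 0 < Z z.1 z.2})
      (isOpen_lt continuous_const hZc) (by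
        rintro ⟨l, x⟩ ⟨-, rfl⟩
        simp [hZdef, altCosh_zero (hb l) ha])
    obtain ⟨ε, hε, hεv⟩ := Metric.isOpen_iff.1 hv 0 (h0v rfl)
    refine ⟨ε / 2, half_pos hε, fun l hl x hx => ?_⟩
    refine (huv ⟨hu hl, hεv ?_⟩ : (l, x) ∈ {z : ℝ × ℝ | 0 < Z z.1 z.2})
    rw [Metric.mem_ball, Real.dist_eq, sub_zero, abs_of_nonneg hx.1]
    linarith [hx.2]
  have hYδ (l : ℝ) (hl : l ∈ Icc m l₀) (x : ℝ) (hx : x ∈ Ioc 0 δ) : 0 < Y l x :=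
    hpos l δ (hδ l hl) x hx
  have hδT : δ ≤ T := by
    by_contra! h
    exact (hYδ l₀ ⟨hml₀, le_rfl⟩ T ⟨hT, h.le⟩).ne' hS
  obtain ⟨⟨l, x₁⟩, ⟨⟨hl, hx₁⟩, hlx⟩, hmin⟩ :=
    ((isCompact_Icc (a := m) (b := l₀)).prod (isCompact_Icc (a := δ) (b := T))).inter_right
      (isClosed_eq hYc continuous_const : IsClosed {z : ℝ × ℝ | Y z.1 z.2 = 0})
      |>.exists_isMinOn ⟨(l₀, T), ⟨⟨hml₀, le_rfl⟩, ⟨hδT, le_rfl⟩⟩, hS⟩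
      (continuous_fst.continuousOn)
  change l ∈ Icc m l₀ at hl
  change x₁ ∈ Icc δ T at hx₁
  change Y l x₁ = 0 at hlx
  have hml : m < l := by
    refine lt_of_le_of_ne hl.1 ?_
    rintro rfl
    refine (hpos m T (fun x hx => ?_) x₁ ⟨hδ0.trans_le hx₁.1, hx₁.2⟩).ne' hlx
    exact zero_lt_one.trans_le (one_le_altCosh (hb m) ha (fun t ht => sub_nonneg.2 (hm t ht))
      (fun t _ => (ha_pos t).le) hx)
  -- Below the least parameter `l` there is no zero in `[δ, T]`; let the parameter tend to `l`.
  have hlt (l' : ℝ) (hl' : l' ∈ Ico m l) (x : ℝ) (hx : x ∈ Icc δ T) : 0 ≤ Y l' x := by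
    have hl'' : l' ∈ Icc m l₀ := ⟨hl'.1, hl'.2.le.trans hl.2⟩
    by_contra! h
    obtain ⟨y, hy, hy0⟩ := intermediate_value_Icc' hx.1 (hYx l').continuousOn
      ⟨h.le, (hYδ l' hl'' δ ⟨hδ0, le_rfl⟩).le⟩
    have := hmin (a := (l', y)) ⟨⟨hl'', ⟨hy.1, hy.2.trans hx.2⟩⟩, hy0⟩
    exact absurd hl'.2 (not_lt.2 this)
  have hnonneg (x : ℝ) (hx : x ∈ Ioc 0 T) : 0 ≤ Y l x := by
    rcases le_total x δ with h | h
    · exact (hYδ l hl x ⟨hx.1, h⟩).le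
    · have hcl : l ∈ closure (Ico m l) := by
        rw [closure_Ico hml.ne]; exact ⟨hml.le, le_rfl⟩
      have hsub : Ico m l ⊆ {l' | 0 ≤ Y l' x} := fun l' hl' => hlt l' hl' x ⟨h, hx.2⟩
      exact closure_minimal hsub
        (isClosed_le continuous_const (hYc.comp (Continuous.prodMk_left x))) hcl
  have hx₁0 : 0 < x₁ := hδ0.trans_le hx₁.1
  -- A zero before `T` would be a minimum of `Y l`, and then both components would vanish there.
  obtain rfl : x₁ = T := by
    by_contra hne
    have hlt : x₁ < T := lt_of_le_of_ne hx₁.2 hne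
    have hloc : IsLocalMin (Y l) x₁ := by
      filter_upwards [Ioo_mem_nhds hx₁0 hlt] with x hx
      rw [hlx]
      exact hnonneg x ⟨hx.1, hx.2.le⟩
    have := hloc.hasDerivAt_eq_zero (hY' l x₁)
    exact hYZ l x₁ hlx ((mul_eq_zero.1 this).resolve_left (ha_pos x₁).ne')
  -- A positive derivative at the zero `T` would make `Y l` negative just before it.
  have hZneg : Z l x₁ < 0 := by
    refine lt_of_le_of_ne ?_ (hYZ l x₁ hlx)
    by_contra! h
    have hd := (hY' l x₁).hasDerivWithinAt (s := Iio x₁)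
    have hd2 : 0 < a x₁ * Z l x₁ := mul_pos (ha_pos _) h
    rw [hasDerivWithinAt_iff_tendsto_slope' (by simp)] at hd
    obtain ⟨x, hx, hx'⟩ := ((hd.eventually (lt_mem_nhds hd2)).and
      (Ioo_mem_nhdsLT hx₁0)).exists
    rw [slope_def_field, hlx, sub_zero] at hx
    have hx2 := hnonneg x ⟨hx'.1, hx'.2.le⟩
    have hx3 : x - x₁ ≤ 0 := by linarith [hx'.2]
    exact absurd hx (not_lt.2 (div_nonpos_of_nonneg_of_nonpos hx2 hx3))
  refine ⟨l, hl, ?_, hlx, hZneg⟩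
  rintro rfl
  exact absurd hC (not_lt.2 hZneg.le)

/-- Below a parameter whose `altSinh` vanishes at `T` with positive quasi-derivative there is one
where the trace of the transfer matrix over `[0, T]` equals `2`. -/
lemma exists_lt_trace_eq_two {a q : ℝ → ℝ} (ha : Continuous a)
    (hq : Continuous q) (ha_pos : ∀ x, 0 < a x) {T l₀ : ℝ} (hT : 0 < T)
    (hS : altSinh a (fun t => q t - l₀) T = 0) (hC : 0 < altCosh (fun t => q t - l₀) a T) :
    ∃ l < l₀, altCosh a (fun t => q t - l) T + altCosh (fun t => q t - l) a T = 2 := by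
  have hb (l : ℝ) : Continuous fun t => q t - l := hq.sub continuous_const
  obtain ⟨m, hml₀, hm⟩ : ∃ m ≤ l₀, ∀ x ∈ Icc 0 T, m ≤ q x := by
    obtain ⟨x, -, hx⟩ := (isCompact_Icc (a := 0) (b := T)).exists_isMinOn ⟨0, le_rfl, hT.le⟩
      hq.continuousOn
    exact ⟨min l₀ (q x), min_le_left _ _, fun y hy => (min_le_right _ _).trans (hx hy)⟩
  obtain ⟨l, hl, hne, hSl, hCl⟩ :=
    exists_lt_altSinh_eq_zero_altCosh_neg ha hq ha_pos hT hml₀ hm hS hC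
  -- The determinant is `1`, so the other diagonal entry is negative too.
  have hCl' : altCosh a (fun t => q t - l) T < 0 := by
    have h := altCosh_mul_sub_altSinh_mul ha (hb l) T
    rw [hSl] at h
    by_contra! h'
    nlinarith [mul_nonneg h' (neg_nonneg.2 hCl.le)]
  have hge : 2 ≤ altCosh a (fun t => q t - m) T + altCosh (fun t => q t - m) a T := by
    have hTT : T ∈ Icc 0 T := ⟨hT.le, le_rfl⟩
    have h1 := one_le_altCosh ha (hb m) (fun t _ => (ha_pos t).le)
      (fun t ht => sub_nonneg.2 (hm t ht)) hTT
    have h2 := one_le_altCosh (hb m) ha (fun t ht => sub_nonneg.2 (hm t ht))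
      (fun t _ => (ha_pos t).le) hTT
    linarith
  have hcont : Continuous fun l =>
      altCosh a (fun t => q t - l) T + altCosh (fun t => q t - l) a T :=
    ((continuous_altCosh_sub ha hq).comp (Continuous.prodMk_left T)).add
      ((continuous_altCosh_sub' ha hq).comp (Continuous.prodMk_left T))
  obtain ⟨l', hl', h⟩ := intermediate_value_Icc' hl.1 hcont.continuousOn
    (show (2 : ℝ) ∈ Icc _ _ from ⟨by linarith, hge⟩)
  exact ⟨l', hl'.2.trans_lt (lt_of_le_of_ne hl.2 hne), h⟩

end Oscillation

/-! ### Hill's equation and its periodic eigenfunctions -/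

section Hill

open Set Filter Topology

/-- A solution of Hill's equation together with its quasi-derivative `p f'` solves the system with
weights `1 / p` and `q - μ`. -/
lemma IsHillSolution.solvesSystem {p q : ℝ → ℝ} (hp_pos : ∀ x, 0 < p x) {μ : ℂ} {f : ℝ → ℂ}
    (hf : IsHillSolution p q μ f) :
    SolvesSystem (fun x => (((p x)⁻¹ : ℝ) : ℂ)) (fun x => (q x : ℂ) - μ) f
      (fun x => (p x : ℂ) * deriv f x) := by
  intro x
  have hpx : (p x : ℂ) ≠ 0 := by exact_mod_cast (hp_pos x).ne'
  constructor
  · refine (hf.1 x).hasDerivAt.congr_deriv ?_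
    push_cast
    field_simp
  · refine (hf.2.1 x).hasDerivAt.congr_deriv ?_
    linear_combination -(hf.2.2 x)

lemma SolvesSystem.deriv_eq {p : ℝ → ℝ} {b u w : ℝ → ℂ} (hp_pos : ∀ x, 0 < p x)
    (h : SolvesSystem (fun x => (((p x)⁻¹ : ℝ) : ℂ)) b u w) (x : ℝ) :
    (p x : ℂ) * deriv u x = w x := by
  have hpx : (p x : ℂ) ≠ 0 := by exact_mod_cast (hp_pos x).ne'
  rw [(h x).1.deriv]
  push_cast
  field_simp

lemma SolvesSystem.isHillSolution {p q : ℝ → ℝ} (hp_pos : ∀ x, 0 < p x) {μ : ℂ} {u w : ℝ → ℂ}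
    (h : SolvesSystem (fun x => (((p x)⁻¹ : ℝ) : ℂ)) (fun x => (q x : ℂ) - μ) u w) :
    IsHillSolution p q μ u := by
  have e : (fun x => (p x : ℂ) * deriv u x) = w := funext (h.deriv_eq hp_pos)
  refine ⟨fun x => (h x).1.differentiableAt, ?_, fun x => ?_⟩
  · rw [e]; exact fun x => (h x).2.differentiableAt
  · rw [e, (h x).2.deriv]; ring

lemma continuous_ofReal_inv {p : ℝ → ℝ} (hp : Continuous p) (hp_pos : ∀ x, 0 < p x) :
    Continuous fun x => (((p x)⁻¹ : ℝ) : ℂ) :=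
  Complex.continuous_ofReal.comp (hp.inv₀ fun x => (hp_pos x).ne')

lemma continuous_ofReal_sub {q : ℝ → ℝ} (hq : Continuous q) (μ : ℂ) :
    Continuous fun x => (q x : ℂ) - μ :=
  (Complex.continuous_ofReal.comp hq).sub continuous_const

lemma exists_isFundamentalSystem {p q : ℝ → ℝ} (hp : Continuous p) (hp_pos : ∀ x, 0 < p x)
    (hq : Continuous q) (μ : ℂ) : ∃ f₁ f₂, IsFundamentalSystem p q μ f₁ f₂ := by
  have ha := continuous_ofReal_inv hp hp_pos
  have hb := continuous_ofReal_sub hq μ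
  have hp0 : (p 0 : ℂ) ≠ 0 := by exact_mod_cast (hp_pos 0).ne'
  have h1 := solvesSystem_altCosh ha hb
  -- The sine-like solution has quasi-derivative `1` at the origin, whence the factor `p 0`.
  have h2 : SolvesSystem (fun x => (((p x)⁻¹ : ℝ) : ℂ)) (fun x => (q x : ℂ) - μ)
      (fun x => p 0 * altSinh (fun x => (((p x)⁻¹ : ℝ) : ℂ)) (fun x => (q x : ℂ) - μ) x)
      (fun x => p 0 * altCosh (fun x => (q x : ℂ) - μ) (fun x => (((p x)⁻¹ : ℝ) : ℂ)) x) :=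
    fun x => ⟨((solvesSystem_altSinh ha hb x).1.const_mul _).congr_deriv (by ring),
      ((solvesSystem_altSinh ha hb x).2.const_mul _).congr_deriv (by ring)⟩
  have e1 := h1.deriv_eq hp_pos 0
  have e2 := h2.deriv_eq hp_pos 0
  rw [altSinh_zero] at e1
  rw [altCosh_zero hb ha] at e2
  refine ⟨_, _, h1.isHillSolution hp_pos, h2.isHillSolution hp_pos, altCosh_zero ha hb,
    (mul_eq_zero.1 e1).resolve_left hp0, ?_, mul_left_cancel₀ hp0 e2⟩
  simp [altSinh_zero]

lemma IsFundamentalSystem.eq_comb {p q : ℝ → ℝ} (hp : Continuous p) (hp_pos : ∀ x, 0 < p x)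
    (hq : Continuous q) {μ : ℂ} {f₁ f₂ f : ℝ → ℂ} (h : IsFundamentalSystem p q μ f₁ f₂)
    (hf : IsHillSolution p q μ f) (x : ℝ) :
    f x = f 0 * f₁ x + deriv f 0 * f₂ x ∧
      deriv f x = f 0 * deriv f₁ x + deriv f 0 * deriv f₂ x := by
  have ha := continuous_ofReal_inv hp hp_pos
  have hb := continuous_ofReal_sub hq μ
  have hpx : (p x : ℂ) ≠ 0 := by exact_mod_cast (hp_pos x).ne'
  obtain ⟨h1, h2, h10, h10', h20, h20'⟩ := h
  have e := (hf.solvesSystem hp_pos).eq_comb ha hb x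
  have e1 := (h1.solvesSystem hp_pos).eq_comb ha hb x
  have e2 := (h2.solvesSystem hp_pos).eq_comb ha hb x
  simp only [h10, h10', h20, h20'] at e1 e2
  constructor
  · rw [e.1, e1.1, e2.1]; ring
  · apply mul_left_cancel₀ hpx
    rw [e.2, mul_add, mul_left_comm, e1.2, mul_left_comm, e2.2]; ring

lemma IsHillSolution.eq_of_eq_zero {p q : ℝ → ℝ} (hp : Continuous p) (hp_pos : ∀ x, 0 < p x)
    (hq : Continuous q) {μ : ℂ} {f g : ℝ → ℂ} (hf : IsHillSolution p q μ f)
    (hg : IsHillSolution p q μ g) (h : f 0 = g 0) (h' : deriv f 0 = deriv g 0) : f = g := by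
  obtain ⟨f₁, f₂, hF⟩ := exists_isFundamentalSystem hp hp_pos hq μ
  ext x
  rw [(hF.eq_comb hp hp_pos hq hf x).1, (hF.eq_comb hp hp_pos hq hg x).1, h, h']

lemma IsHillSolution.shift {p q : ℝ → ℝ} {μ : ℂ} {f : ℝ → ℂ} (hf : IsHillSolution p q μ f)
    (s : ℝ) :
    IsHillSolution (fun x => p (x + s)) (fun x => q (x + s)) μ (fun x => f (x + s)) := by
  have e : (fun x => ((p (x + s) : ℝ) : ℂ) * deriv (fun x => f (x + s)) x) =
      fun x => (fun y => (p y : ℂ) * deriv f y) (x + s) := by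
    ext x; rw [deriv_comp_add_const]
  refine ⟨hf.1.comp (differentiable_id.add_const s), ?_, fun x => ?_⟩
  · rw [e]; exact hf.2.1.comp (differentiable_id.add_const s)
  · rw [e, deriv_comp_add_const (fun y => (p y : ℂ) * deriv f y)]; exact hf.2.2 (x + s)

/-- The translate of an eigenfunction by a period solves the same equation with the same initial
data, so the boundary conditions make the eigenfunction periodic on the whole line. -/
lemma IsPeriodicEigenfunction.periodic {p q : ℝ → ℝ} {T : ℝ} (hp : Continuous p)
    (hp_pos : ∀ x, 0 < p x) (hp_per : Function.Periodic p T) (hq : Continuous q)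
    (hq_per : Function.Periodic q T) {μ : ℂ} {f : ℝ → ℂ}
    (hf : IsPeriodicEigenfunction p q T μ f) : Function.Periodic f T := by
  have h := hf.1.shift T
  simp only [hp_per _, hq_per _] at h
  refine congrFun (h.eq_of_eq_zero hp hp_pos hq hf.1 ?_ ?_)
  · simpa using hf.2.2.1.symm
  · rw [deriv_comp_add_const, zero_add]; exact hf.2.2.2.symm

lemma IsPeriodicEigenfunction.shift {p q : ℝ → ℝ} {T : ℝ} (hp : Continuous p)
    (hp_pos : ∀ x, 0 < p x) (hp_per : Function.Periodic p T) (hq : Continuous q)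
    (hq_per : Function.Periodic q T) {μ : ℂ} {f : ℝ → ℂ}
    (hf : IsPeriodicEigenfunction p q T μ f) (s : ℝ) :
    IsPeriodicEigenfunction (fun x => p (x + s)) (fun x => q (x + s)) T μ
      (fun x => f (x + s)) := by
  have hper := hf.periodic hp hp_pos hp_per hq hq_per
  refine ⟨hf.1.shift s, fun h => hf.2.1 ?_, ?_, ?_⟩
  · ext x
    simpa using congrFun h (x - s)
  · simpa [add_comm T s] using (hper s).symm
  · rw [deriv_comp_add_const, deriv_comp_add_const, zero_add, add_comm T s,
      ← deriv_comp_add_const f T s, funext hper]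

/-- If the transfer matrix over a period, whose determinant is `1`, has trace `2`, then it has the
eigenvalue `1`, and an eigenvector gives the initial data of a periodic eigenfunction. -/
lemma exists_isPeriodicEigenfunction_of_trace {p q : ℝ → ℝ} {T : ℝ} (hp : Continuous p)
    (hp_pos : ∀ x, 0 < p x) (hp_per : Function.Periodic p T) (hq : Continuous q) {μ : ℂ}
    (h : altCosh (fun x => (((p x)⁻¹ : ℝ) : ℂ)) (fun x => (q x : ℂ) - μ) T +
      altCosh (fun x => (q x : ℂ) - μ) (fun x => (((p x)⁻¹ : ℝ) : ℂ)) T = 2) :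
    ∃ f, IsPeriodicEigenfunction p q T μ f := by
  have ha := continuous_ofReal_inv hp hp_pos
  have hb := continuous_ofReal_sub hq μ
  have hdet := altCosh_mul_sub_altSinh_mul ha hb T
  set a : ℝ → ℂ := fun x => (((p x)⁻¹ : ℝ) : ℂ) with hadef
  set b : ℝ → ℂ := fun x => (q x : ℂ) - μ
  obtain ⟨α, β, hne, h1, h2⟩ : ∃ α β : ℂ, (α ≠ 0 ∨ β ≠ 0) ∧
      α * altCosh a b T + β * altSinh a b T = α ∧
      α * altSinh b a T + β * altCosh b a T = β := by
    by_cases hS : altSinh a b T = 0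
    · refine ⟨0, 1, Or.inr one_ne_zero, by simp [hS], ?_⟩
      rw [hS] at hdet
      -- The diagonal entries have sum `2` and product `1`, so both are `1`.
      have hsq : (altCosh b a T - 1) ^ 2 = 0 := by
        linear_combination altCosh b a T * h - hdet
      have := sub_eq_zero.1 (pow_eq_zero_iff two_ne_zero |>.1 hsq)
      simp [this]
    · refine ⟨altSinh a b T, 1 - altCosh a b T, Or.inl hS, by ring, ?_⟩
      linear_combination h - hdet
  have hsol : SolvesSystem a b (fun x => α * altCosh a b x + β * altSinh a b x)
      (fun x => α * altSinh b a x + β * altCosh b a x) := fun x =>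
    ⟨(((hasDerivAt_altCosh ha hb x).const_mul α).add
      ((hasDerivAt_altSinh ha hb x).const_mul β)).congr_deriv (by ring),
    (((hasDerivAt_altSinh hb ha x).const_mul α).add
      ((hasDerivAt_altCosh hb ha x).const_mul β)).congr_deriv (by ring)⟩
  have hd := hsol.deriv_eq hp_pos
  have hp0 : (p 0 : ℂ) ≠ 0 := by exact_mod_cast (hp_pos 0).ne'
  have hpT : p T = p 0 := by simpa using hp_per 0
  refine ⟨_, hsol.isHillSolution hp_pos, fun h0 => ?_, ?_, ?_⟩
  · have hα := congrFun h0 0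
    have hβ := hd 0
    simp only [h0] at hβ
    simp [altCosh_zero ha hb, altSinh_zero] at hα
    simp [altCosh_zero hb ha, altSinh_zero] at hβ
    exact hne.elim (fun h => h hα) (fun h => h hβ.symm)
  · simp [altCosh_zero ha hb, altSinh_zero, h1]
  · apply mul_left_cancel₀ hp0
    rw [hd 0, ← hpT, hd T, h2]
    simp [altCosh_zero hb ha, altSinh_zero]

/-- An eigenfunction of the periodic problem that vanishes at the origin is a multiple of the
sine-like solution, so there is a smaller periodic eigenvalue. -/
lemma exists_lt_isPeriodicEigenfunction_of_eq_zero {p q : ℝ → ℝ} {T : ℝ} (hT : 0 < T)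
    (hp : Continuous p) (hp_pos : ∀ x, 0 < p x) (hp_per : Function.Periodic p T)
    (hq : Continuous q) {l₀ : ℝ} {f : ℝ → ℂ} (hf : IsPeriodicEigenfunction p q T l₀ f)
    (hf0 : f 0 = 0) : ∃ l < l₀, ∃ g, IsPeriodicEigenfunction p q T ((l : ℝ) : ℂ) g := by
  have hpinv : Continuous fun x => (p x)⁻¹ := hp.inv₀ fun x => (hp_pos x).ne'
  have ha := continuous_ofReal_inv hp hp_pos
  have hb := continuous_ofReal_sub hq (l₀ : ℂ)
  have hcast (l : ℝ) : (fun x => (q x : ℂ) - (l : ℂ)) = fun x => ((q x - l : ℝ) : ℂ) := by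
    ext x; push_cast; rfl
  have hp0 : (p 0 : ℂ) ≠ 0 := by exact_mod_cast (hp_pos 0).ne'
  have hpT : p T = p 0 := by simpa using hp_per 0
  obtain ⟨hsol, hne, hval, hder⟩ := hf
  have hd0 : (p 0 : ℂ) * deriv f 0 ≠ 0 := by
    intro h0
    apply hne
    ext x
    rw [((hsol.solvesSystem hp_pos).eq_comb ha hb x).1, hf0, h0]
    simp
  obtain ⟨e1, e2⟩ := (hsol.solvesSystem hp_pos).eq_comb ha hb T
  rw [hf0, zero_mul, zero_add] at e1 e2
  rw [← hval, hf0, eq_comm, mul_eq_zero] at e1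
  have hS := e1.resolve_left hd0
  rw [hpT, ← hder] at e2
  have hC := mul_left_cancel₀ hd0 ((mul_one _).trans e2)
  rw [hcast, altSinh_ofReal] at hS
  rw [hcast, altCosh_ofReal] at hC
  obtain ⟨l, hl, htr⟩ := exists_lt_trace_eq_two (a := fun x => (p x)⁻¹) hpinv hq
    (fun x => inv_pos.2 (hp_pos x)) hT (by exact_mod_cast hS)
    (by rw [← Complex.ofReal_injective (hC : ((1 : ℝ) : ℂ) = _)]; exact one_pos)
  refine ⟨l, hl, exists_isPeriodicEigenfunction_of_trace hp hp_pos hp_per hq ?_⟩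
  rw [hcast, altCosh_ofReal, altCosh_ofReal]
  exact_mod_cast htr

/-- The eigenfunction of the lowest periodic eigenvalue has no zeros: a zero could be moved to the
origin by a translation, which does not change the periodic eigenvalues. -/
lemma IsPeriodicEigenfunction.ne_zero_of_isLeast {p q : ℝ → ℝ} {T : ℝ} (hT : 0 < T)
    (hp : Continuous p) (hp_pos : ∀ x, 0 < p x) (hp_per : Function.Periodic p T)
    (hq : Continuous q) (hq_per : Function.Periodic q T) {l₀ : ℝ}
    (hl₀ : IsLeast (periodicEigenvalues p q T) l₀) {f : ℝ → ℂ}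
    (hf : IsPeriodicEigenfunction p q T l₀ f) (x : ℝ) : f x ≠ 0 := by
  intro hx
  have hshift : Continuous fun y : ℝ => y + x := by fun_prop
  have hp_per' : Function.Periodic (fun y => p (y + x)) T := fun y => by
    simpa only [add_right_comm] using hp_per (y + x)
  have hq_per' : Function.Periodic (fun y => q (y + x)) T := fun y => by
    simpa only [add_right_comm] using hq_per (y + x)
  obtain ⟨l, hl, g, hg⟩ := exists_lt_isPeriodicEigenfunction_of_eq_zero hT (hp.comp hshift)
    (fun y => hp_pos (y + x)) hp_per' (hq.comp hshift)
    (hf.shift hp hp_pos hp_per hq hq_per x) (by simpa using hx)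
  have hback := hg.shift (hp.comp hshift) (fun y => hp_pos (y + x)) hp_per' (hq.comp hshift)
    hq_per' (-x)
  simp only [Function.comp, neg_add_cancel_right] at hback
  exact absurd hl (not_lt.2 (hl₀.2 ⟨_, hback⟩))

end Hill

/-! ### The power series of Hill's discriminant -/

section Discriminant

open Set Filter Topology

lemma sppsXTilde_eq_altInt (p : ℝ → ℝ) (f₀ : ℝ → ℂ) (n : ℕ) :
    sppsXTilde p f₀ (2 * n) = altInt (2 * n) (fun x => -(1 / ((p x : ℂ) * f₀ x ^ 2)))
      (fun x => f₀ x ^ 2) := by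
  induction n with
  | zero => rfl
  | succ n ih =>
    have e1 : sppsXTilde p f₀ (2 * n + 1) = altInt (2 * n + 1) (fun x => f₀ x ^ 2)
        (fun x => -(1 / ((p x : ℂ) * f₀ x ^ 2))) := by
      ext x
      rw [sppsXTilde]
      beta_reduce
      rw [if_pos (odd_two_mul_add_one n), ih, altInt]
      simp only [mul_comm]
    have hodd : ¬ Odd (2 * n + 1 + 1) := by
      rw [Nat.not_odd_iff_even]; exact ⟨n + 1, by ring⟩
    ext x
    rw [show 2 * (n + 1) = 2 * n + 1 + 1 by ring]
    rw [sppsXTilde]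
    beta_reduce
    rw [if_neg hodd, e1, altInt,
      ← intervalIntegral.integral_neg]
    congr 1; ext t; ring

lemma sppsX_eq_altInt (p : ℝ → ℝ) (f₀ : ℝ → ℂ) (n : ℕ) :
    sppsX p f₀ (2 * n) = altInt (2 * n) (fun x => f₀ x ^ 2)
      (fun x => -(1 / ((p x : ℂ) * f₀ x ^ 2))) := by
  induction n with
  | zero => rfl
  | succ n ih =>
    have e1 : sppsX p f₀ (2 * n + 1) = altInt (2 * n + 1)
        (fun x => -(1 / ((p x : ℂ) * f₀ x ^ 2))) (fun x => f₀ x ^ 2) := by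
      ext x
      rw [sppsX]
      beta_reduce
      rw [if_pos (odd_two_mul_add_one n), ih, altInt, ← intervalIntegral.integral_neg]
      congr 1; ext t; ring
    have hodd : ¬ Odd (2 * n + 1 + 1) := by
      rw [Nat.not_odd_iff_even]; exact ⟨n + 1, by ring⟩
    ext x
    rw [show 2 * (n + 1) = 2 * n + 1 + 1 by ring]
    rw [sppsX]
    beta_reduce
    rw [if_neg hodd, e1, altInt]
    simp only [mul_comm]

/-- Reduction of order: if `f₀` is a solution without zeros for the parameter `l₀` and `(v, w)`
solves the system with weights `-1 / (p f₀²)` and `(μ - l₀) f₀²`, then `f₀ v` is a solution for the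
parameter `μ`, with quasi-derivative `(p f₀') v - w / f₀`. -/
lemma solvesSystem_mul {p q : ℝ → ℝ} (hp_pos : ∀ x, 0 < p x) {l₀ μ : ℂ} {f₀ v w : ℝ → ℂ}
    (hf₀ : IsHillSolution p q l₀ f₀) (hne : ∀ x, f₀ x ≠ 0)
    (h : SolvesSystem (fun x => -(1 / ((p x : ℂ) * f₀ x ^ 2))) (fun x => (μ - l₀) * f₀ x ^ 2) v w) :
    SolvesSystem (fun x => (((p x)⁻¹ : ℝ) : ℂ)) (fun x => (q x : ℂ) - μ) (fun x => f₀ x * v x)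
      (fun x => p x * deriv f₀ x * v x - w x / f₀ x) := by
  intro x
  have hpx : (p x : ℂ) ≠ 0 := by exact_mod_cast (hp_pos x).ne'
  have hfx := hne x
  obtain ⟨h1, h2⟩ := hf₀.solvesSystem hp_pos x
  obtain ⟨h3, h4⟩ := h x
  constructor
  · refine (h1.mul h3).congr_deriv ?_
    push_cast
    field_simp
    ring
  · refine ((h2.mul h3).sub (h4.div h1 hfx)).congr_deriv ?_
    push_cast
    field_simp
    ring

/-- Hill's discriminant through a periodic solution `f₀` without zeros: the trace of the transfer
matrix is that of the system obtained by reduction of order. -/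
lemma IsFundamentalSystem.trace_eq {p q : ℝ → ℝ} {T : ℝ} (hp : Continuous p)
    (hp_pos : ∀ x, 0 < p x) (hp_per : Function.Periodic p T) (hq : Continuous q) {l₀ μ : ℂ}
    {f₀ f₁ f₂ : ℝ → ℂ} (hf₀ : IsPeriodicEigenfunction p q T l₀ f₀) (hne : ∀ x, f₀ x ≠ 0)
    (hF : IsFundamentalSystem p q μ f₁ f₂) :
    f₁ T + deriv f₂ T =
      altCosh (fun x => -(1 / ((p x : ℂ) * f₀ x ^ 2))) (fun x => (μ - l₀) * f₀ x ^ 2) T +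
      altCosh (fun x => (μ - l₀) * f₀ x ^ 2) (fun x => -(1 / ((p x : ℂ) * f₀ x ^ 2))) T := by
  have hpT : p T = p 0 := by simpa using hp_per 0
  have hpx (x : ℝ) : (p x : ℂ) ≠ 0 := by exact_mod_cast (hp_pos x).ne'
  obtain ⟨hsol, -, hval, hder⟩ := hf₀
  have hf₀c : Continuous f₀ := hsol.1.continuous
  have hα : Continuous fun x => -(1 / ((p x : ℂ) * f₀ x ^ 2)) :=
    (continuous_const.div ((Complex.continuous_ofReal.comp hp).mul (hf₀c.pow 2))
      fun x => mul_ne_zero (hpx x) (pow_ne_zero 2 (hne x))).neg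
  have hβ : Continuous fun x => (μ - l₀) * f₀ x ^ 2 := continuous_const.mul (hf₀c.pow 2)
  have h1 := solvesSystem_mul hp_pos hsol hne (solvesSystem_altCosh hα hβ)
  have h2 := solvesSystem_mul hp_pos hsol hne (solvesSystem_altSinh hα hβ)
  have d1 := h1.deriv_eq hp_pos
  have d2 := h2.deriv_eq hp_pos
  have e1 := (hF.eq_comb hp hp_pos hq (h1.isHillSolution hp_pos) T).1
  obtain ⟨e2, e2'⟩ := hF.eq_comb hp hp_pos hq (h2.isHillSolution hp_pos) T
  have d10 := d1 0
  have d20 := d2 0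
  have d2T := d2 T
  simp only [altCosh_zero hα hβ, altCosh_zero hβ hα, altSinh_zero, mul_one, mul_zero, zero_mul,
    zero_add, zero_div, zero_sub, sub_zero] at e1 e2 e2' d10 d20
  rw [hpT, ← hval, ← hder] at d2T
  rw [← hval] at e1 e2
  have hf0 := hne 0
  have hp0 := hpx 0
  rw [mul_left_cancel₀ hp0 d10] at e1
  have d20' := (eq_div_iff hp0).2 ((mul_comm _ _).trans d20)
  rw [d20'] at e2 e2'
  rw [e2'] at d2T
  generalize altCosh (fun x => -(1 / ((p x : ℂ) * f₀ x ^ 2))) (fun x => (μ - l₀) * f₀ x ^ 2) T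
    = V at *
  generalize altCosh (fun x => (μ - l₀) * f₀ x ^ 2) (fun x => -(1 / ((p x : ℂ) * f₀ x ^ 2))) T
    = W at *
  generalize altSinh (fun x => -(1 / ((p x : ℂ) * f₀ x ^ 2))) (fun x => (μ - l₀) * f₀ x ^ 2) T
    = S at *
  field_simp at e1 e2 d2T
  apply mul_left_cancel₀ hf0
  linear_combination -e1 - f₀ 0 * d2T - deriv f₀ 0 * e2

end Discriminant

theorem mainTheorem2 (p q : ℝ → ℝ) (T : ℝ) (hT : 0 < T)
    (hp : ContDiff ℝ 1 p) (hp_pos : ∀ x, 0 < p x) (hp_per : Function.Periodic p T)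
    (hq : Continuous q) (hq_per : Function.Periodic q T)
    (lam₀ : ℝ) (hlam₀ : IsLeast (periodicEigenvalues p q T) lam₀)
    (f₀ : ℝ → ℂ) (hf₀ : IsPeriodicEigenfunction p q T (lam₀ : ℂ) f₀) :
    (∀ x : ℝ, f₀ x ≠ 0) ∧
    ∃ D : ℂ → ℂ, IsHillDiscriminant p q T D ∧
      (∀ μ : ℂ, HasSum
        (fun n : ℕ => (sppsXTilde p f₀ (2 * n) T + sppsX p f₀ (2 * n) T) * (μ - (lam₀ : ℂ)) ^ n)
        (D μ)) ∧
      ∀ K : Set ℂ, IsCompact K →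
        TendstoUniformlyOn
          (fun (N : ℕ) (μ : ℂ) => ∑ n ∈ Finset.range N,
            (sppsXTilde p f₀ (2 * n) T + sppsX p f₀ (2 * n) T) * (μ - (lam₀ : ℂ)) ^ n)
          D Filter.atTop K := by
  have hpc := hp.continuous
  have hne : ∀ x, f₀ x ≠ 0 := hf₀.ne_zero_of_isLeast hT hpc hp_pos hp_per hq hq_per hlam₀
  have hf₀c : Continuous f₀ := hf₀.1.1.continuous
  have hα : Continuous fun x => -(1 / ((p x : ℂ) * f₀ x ^ 2)) :=
    (continuous_const.div ((Complex.continuous_ofReal.comp hpc).mul (hf₀c.pow 2))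
      fun x => mul_ne_zero (Complex.ofReal_ne_zero.2 (hp_pos x).ne') (pow_ne_zero 2 (hne x))).neg
  have hsum (μ : ℂ) : HasSum
      (fun n : ℕ => (sppsXTilde p f₀ (2 * n) T + sppsX p f₀ (2 * n) T) * (μ - (lam₀ : ℂ)) ^ n)
      (altCosh (fun x => -(1 / ((p x : ℂ) * f₀ x ^ 2))) (fun x => (μ - lam₀) * f₀ x ^ 2) T +
      altCosh (fun x => (μ - lam₀) * f₀ x ^ 2) (fun x => -(1 / ((p x : ℂ) * f₀ x ^ 2))) T) := by
    have hβ : Continuous fun x => (μ - lam₀) * f₀ x ^ 2 := continuous_const.mul (hf₀c.pow 2)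
    have e (n : ℕ) : (sppsXTilde p f₀ (2 * n) T + sppsX p f₀ (2 * n) T) * (μ - (lam₀ : ℂ)) ^ n =
        altInt (2 * n) (fun x => -(1 / ((p x : ℂ) * f₀ x ^ 2))) (fun x => (μ - lam₀) * f₀ x ^ 2) T +
        altInt (2 * n) (fun x => (μ - lam₀) * f₀ x ^ 2)
          (fun x => -(1 / ((p x : ℂ) * f₀ x ^ 2))) T := by
      rw [sppsXTilde_eq_altInt, sppsX_eq_altInt, (altInt_const_mul_even _ n _ _ T).1,
        (altInt_const_mul_even _ n _ _ T).2]
      ring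
    rw [funext e]
    exact (summable_altInt two_mul_injective hα hβ T).hasSum.add
      (summable_altInt two_mul_injective hβ hα T).hasSum
  refine ⟨hne, _, fun μ => ⟨exists_isFundamentalSystem hpc hp_pos hq μ, fun f₁ f₂ hF =>
    (hF.trace_eq hpc hp_pos hp_per hq hf₀ hne).symm⟩, hsum, fun K hK => ?_⟩
  obtain ⟨R, hR⟩ := hK.exists_bound_of_continuousOn
    (f := fun μ : ℂ => μ - lam₀) (by fun_prop)
  -- Absolute convergence at the single point `lam₀ + |R|` dominates the series on `K`.
  have hbound : Summable fun n : ℕ =>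
      ‖sppsXTilde p f₀ (2 * n) T + sppsX p f₀ (2 * n) T‖ * |R| ^ n := by
    have := (hsum (lam₀ + (|R| : ℝ))).summable.norm
    simpa using this
  simp_rw [← fun μ => (hsum μ).tsum_eq]
  refine tendstoUniformlyOn_tsum_nat hbound fun n μ hμ => ?_
  rw [norm_mul, norm_pow]
  gcongr
  exact (hR μ hμ).trans (le_abs_self R)
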